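/- There is a universal constant $c>0.1798$ with the following property. Let $n\ge 0$, let $\Omega_1,\dots,\Omega_n$ be finite sets, and for each $i$ let $P_i$ and $Q_i$ be probability distributions on $\Omega_i$. For distributions $P,Q$ on a finite set $\Omega$ write $\mathrm{TV}(P,Q)=\frac12\sum_{\omega\in\Omega}|P(\omega)-Q(\omega)|$, let $P^\otimes_{1:n}=P_1\otimes\cdots\otimes P_n$ and $Q^\otimes_{1:n}=Q_1\otimes\cdots\otimes Q_n$ be the product measures on $\Omega_1\times\cdots\times\Omega_n$, and let $\boldsymbol\delta=(\mathrm{TV}(P_1,Q_1),\dots,\mathrm{TV}(P_n,Q_n))\in\mathbb{R}^n$. Then $$\mathrm{TV}(P^\otimes_{1:n},Q^\otimes_{1:n})\ \ge\ c\,\min\{1,\|\boldsymbol\delta\|_2\},$$ where $\|\boldsymbol\delta\|_2=\big(\sum_{i=1}^n\mathrm{TV}(P_i,Q_i)^2\big)^{1/2}$. -/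

import Mathlib

open MeasureTheory

/-- The total variation distance `(1/2) ∑ ω, |P(ω) - Q(ω)|` of two distributions on a finite set,
where `P(ω) = P({ω})`. -/
noncomputable def tvDist {α : Type*} [Fintype α] [MeasurableSpace α] (P Q : Measure α) : ℝ :=
  (1 / 2) * ∑ ω : α, |P.real {ω} - Q.real {ω}|

/-- The vector of marginal total variation distances of two families of distributions, as an
element of Euclidean space, so that its norm is the `ℓ²` norm. -/
noncomputable def marginalTV {n : ℕ} {Ω : Fin n → Type*} [∀ i, Fintype (Ω i)]
    [∀ i, MeasurableSpace (Ω i)] (P Q : ∀ i, Measure (Ω i)) : EuclideanSpace ℝ (Fin n) :=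
  WithLp.toLp 2 fun i => tvDist (P i) (Q i)

/-! Test the product measures against a product of complex functions `ψ i` of modulus at most 1. The
means of `ψ i` under `P i` and `Q i` are conjugate, `√(1 - y²) ± i y δ / 2`, so the product
expectations are `z` and its conjugate, and `z.im` bounds the total variation from below
(`im_prod_le_sum_abs_prod_sub_prod`). To first order `z.im` is a multiple of `∑ y δ` as long as `∑
y²` stays below 1 (`le_im_prod`); taking `y` parallel to `δ` turns this into the `ℓ²` norm. -/

/-- Taylor-type bounds for the real and imaginary parts of `∏ (1 + i τ_j)`. -/
theorem prod_one_add_mul_I_bounds {ι : Type*} (s : Finset ι) (τ : ι → ℝ)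
    (hτ : ∀ i ∈ s, 0 ≤ τ i) (hT : ∑ i ∈ s, τ i ≤ 2) :
    (∏ i ∈ s, (1 + (τ i : ℂ) * Complex.I)).re ≤ 1 ∧
    1 - (∑ i ∈ s, τ i) ^ 2 / 2 ≤ (∏ i ∈ s, (1 + (τ i : ℂ) * Complex.I)).re ∧
    (∏ i ∈ s, (1 + (τ i : ℂ) * Complex.I)).im ≤ ∑ i ∈ s, τ i ∧
    (∑ i ∈ s, τ i) - (∑ i ∈ s, τ i) ^ 3 / 6 ≤
      (∏ i ∈ s, (1 + (τ i : ℂ) * Complex.I)).im := by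
  classical
  -- The four bounds feed each other: each new factor mixes real and imaginary parts.
  induction s using Finset.induction_on with
  | empty => simp
  | insert j s hj ih =>
    have h0 : 0 ≤ τ j := hτ j (Finset.mem_insert_self j s)
    have hs : ∀ i ∈ s, 0 ≤ τ i := fun i hi => hτ i (Finset.mem_insert_of_mem hi)
    have hT0 : 0 ≤ ∑ i ∈ s, τ i := Finset.sum_nonneg hs
    rw [Finset.sum_insert hj] at hT ⊢
    rw [Finset.prod_insert hj]
    obtain ⟨h1, h2, h3, h4⟩ := ih hs (by linarith)
    set z := ∏ i ∈ s, (1 + (τ i : ℂ) * Complex.I)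
    set T := ∑ i ∈ s, τ i
    have hre : ((1 + (τ j : ℂ) * Complex.I) * z).re = z.re - τ j * z.im := by
      simp [Complex.mul_re]
    have him : ((1 + (τ j : ℂ) * Complex.I) * z).im = z.im + τ j * z.re := by
      simp [Complex.mul_im]
    rw [hre, him]
    have hT2 : T ^ 2 ≤ 4 := by nlinarith
    have hz : 0 ≤ z.im := by nlinarith [mul_nonneg hT0 (by linarith : 0 ≤ 6 - T ^ 2)]
    have e1 := mul_nonneg h0 hz
    have e2 := mul_le_mul_of_nonneg_left h3 h0
    have e3 := mul_le_mul_of_nonneg_left h1 h0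
    have e4 := mul_le_mul_of_nonneg_left h2 h0
    have e5 : 0 ≤ T * τ j ^ 2 := by positivity
    have e6 : 0 ≤ τ j ^ 3 := by positivity
    refine ⟨by linarith, by nlinarith, by linarith, by nlinarith⟩

theorem one_sub_sum_le_prod_one_sub {ι : Type*} (s : Finset ι) (x : ι → ℝ)
    (h0 : ∀ i ∈ s, 0 ≤ x i) (h1 : ∑ i ∈ s, x i ≤ 1) :
    1 - ∑ i ∈ s, x i ≤ ∏ i ∈ s, (1 - x i) := by
  classical
  induction s using Finset.induction_on with
  | empty => simp
  | insert j s hj ih =>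
    have hx : ∀ i ∈ s, 0 ≤ x i := fun i hi => h0 i (Finset.mem_insert_of_mem hi)
    have hj0 : 0 ≤ x j := h0 j (Finset.mem_insert_self j s)
    have hs0 := Finset.sum_nonneg hx
    rw [Finset.sum_insert hj] at h1 ⊢
    rw [Finset.prod_insert hj]
    have := mul_le_mul_of_nonneg_left (ih hx (by linarith)) (by linarith : 0 ≤ 1 - x j)
    nlinarith [mul_nonneg hj0 hs0]

/-- Lower bound for the imaginary part of `∏ (√(1 - y_j²) + i y_j δ_j / 2)`. -/
theorem le_im_prod {ι : Type*} (s : Finset ι) (y δ : ι → ℝ)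
    (hy : ∀ i ∈ s, 0 ≤ y i) (hδ : ∀ i ∈ s, 0 ≤ δ i)
    (hy2 : ∑ i ∈ s, y i ^ 2 ≤ 0.49) (hyδ : ∑ i ∈ s, y i * δ i ≤ 0.7) :
    0.3 * ∑ i ∈ s, y i * δ i ≤
      (∏ i ∈ s, ((√(1 - y i ^ 2) : ℂ) + ((y i * δ i / 2 : ℝ) : ℂ) * Complex.I)).im := by
  have ha2 : ∀ i ∈ s, 0.51 ≤ 1 - y i ^ 2 := fun i hi => by
    have := Finset.single_le_sum (f := fun i => y i ^ 2) (fun i _ => sq_nonneg _) hi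
    linarith
  have ha : ∀ i ∈ s, 0.7 ≤ √(1 - y i ^ 2) := fun i hi =>
    Real.le_sqrt_of_sq_le (by linarith [ha2 i hi])
  have ha1 : ∀ i ∈ s, √(1 - y i ^ 2) ≤ 1 := fun i _ =>
    Real.sqrt_le_one.2 (by linarith [sq_nonneg (y i)])
  set τ : ι → ℝ := fun i => y i * δ i / 2 / √(1 - y i ^ 2) with hτ
  have hτ0 : ∀ i ∈ s, 0 ≤ τ i := fun i hi =>
    div_nonneg (by linarith [mul_nonneg (hy i hi) (hδ i hi)]) (Real.sqrt_nonneg _)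
  have hlow : (∑ i ∈ s, y i * δ i) / 2 ≤ ∑ i ∈ s, τ i := by
    rw [Finset.sum_div]
    refine Finset.sum_le_sum fun i hi => ?_
    rw [hτ, le_div_iff₀ (by linarith [ha i hi])]
    exact mul_le_of_le_one_right (by linarith [mul_nonneg (hy i hi) (hδ i hi)]) (ha1 i hi)
  have hup : ∑ i ∈ s, τ i ≤ 5 / 7 * ∑ i ∈ s, y i * δ i := by
    rw [Finset.mul_sum]
    refine Finset.sum_le_sum fun i hi => ?_
    have := mul_nonneg (hy i hi) (hδ i hi)
    rw [hτ, div_le_iff₀ (by linarith [ha i hi])]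
    linarith [mul_le_mul_of_nonneg_left (ha i hi) this]
  have hprod : ∏ i ∈ s, ((√(1 - y i ^ 2) : ℂ) + ((y i * δ i / 2 : ℝ) : ℂ) * Complex.I) =
      ((∏ i ∈ s, √(1 - y i ^ 2) : ℝ) : ℂ) * ∏ i ∈ s, (1 + (τ i : ℂ) * Complex.I) := by
    rw [Complex.ofReal_prod, ← Finset.prod_mul_distrib]
    refine Finset.prod_congr rfl fun i hi => ?_
    have hne : √(1 - y i ^ 2) ≠ 0 := by linarith [ha i hi]
    have : y i * δ i / 2 = √(1 - y i ^ 2) * τ i := by rw [hτ]; field_simp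
    rw [this]
    push_cast
    ring
  -- The squared product is at least `1 - 0.49 = 0.51 > 0.7²`.
  have hA : 0.7 ≤ ∏ i ∈ s, √(1 - y i ^ 2) := by
    have hsq : (∏ i ∈ s, √(1 - y i ^ 2)) ^ 2 = ∏ i ∈ s, (1 - y i ^ 2) := by
      rw [← Finset.prod_pow]
      exact Finset.prod_congr rfl fun i hi => Real.sq_sqrt (by linarith [ha2 i hi])
    have := one_sub_sum_le_prod_one_sub s (fun i => y i ^ 2) (fun i _ => sq_nonneg _)
      (by linarith)
    exact (sq_le_sq₀ (by norm_num) (Finset.prod_nonneg fun i _ => Real.sqrt_nonneg _)).1 (by linarith)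
  rw [hprod, Complex.im_ofReal_mul]
  obtain ⟨-, -, -, him⟩ := prod_one_add_mul_I_bounds s τ hτ0 (by linarith)
  set T := ∑ i ∈ s, τ i
  have hT0 : 0 ≤ T := Finset.sum_nonneg hτ0
  have hT2 : T ^ 2 ≤ 1 / 4 := by nlinarith
  have him' : 23 / 24 * T ≤ (∏ i ∈ s, (1 + (τ i : ℂ) * Complex.I)).im := by
    nlinarith [mul_le_mul_of_nonneg_left hT2 hT0]
  -- `0.7 * (23/24) * (1/2) > 0.3`.
  have := mul_le_mul hA him' (by positivity) (by linarith)
  linarith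

/-- Total variation controls expectations of test functions bounded by `1`. -/
theorem norm_sum_sub_mul_le {α : Type*} [Fintype α] (p q : α → ℝ) (ψ : α → ℂ)
    (hψ : ∀ x, ‖ψ x‖ ≤ 1) :
    ‖∑ x, (p x : ℂ) * ψ x - ∑ x, (q x : ℂ) * ψ x‖ ≤ ∑ x, |p x - q x| := by
  rw [← Finset.sum_sub_distrib]
  refine (norm_sum_le _ _).trans (Finset.sum_le_sum fun x _ => ?_)
  rw [← sub_mul, ← Complex.ofReal_sub, norm_mul, Complex.norm_real, Real.norm_eq_abs]
  exact mul_le_of_le_one_right (abs_nonneg _) (hψ x)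

/-- A test function whose expectations under two distributions at total variation distance `δ`
are the conjugate numbers `√(1 - y²) ± i y δ / 2`. -/
theorem exists_test_function {α : Type*} [Fintype α] (p q : α → ℝ) (hp : ∀ x, 0 ≤ p x)
    (hq : ∀ x, 0 ≤ q x) (hp1 : ∑ x, p x = 1) (hq1 : ∑ x, q x = 1) {y : ℝ} (hy : y ^ 2 ≤ 1) :
    ∃ ψ : α → ℂ, (∀ x, ‖ψ x‖ ≤ 1) ∧
      ∑ x, (p x : ℂ) * ψ x =
        (√(1 - y ^ 2) : ℂ) + ((y * ((1 / 2) * ∑ x, |p x - q x|) / 2 : ℝ) : ℂ) * Complex.I ∧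
      ∑ x, (q x : ℂ) * ψ x =
        (√(1 - y ^ 2) : ℂ) - ((y * ((1 / 2) * ∑ x, |p x - q x|) / 2 : ℝ) : ℂ) * Complex.I := by
  classical
  set f : α → ℝ := fun x => if q x ≤ p x then 1 else 0 with hf
  have hf0 : ∀ x, 0 ≤ f x := fun x => by simp only [hf]; split_ifs <;> norm_num
  have hf1 : ∀ x, f x ≤ 1 := fun x => by simp only [hf]; split_ifs <;> norm_num
  set u := ∑ x, p x * f x with hu
  set v := ∑ x, q x * f x with hv
  have hδ : (1 / 2) * ∑ x, |p x - q x| = u - v := by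
    have : ∀ x, |p x - q x| = 2 * (p x * f x) - 2 * (q x * f x) - (p x - q x) := fun x => by
      simp only [hf]
      split_ifs with h
      · rw [abs_of_nonneg (by linarith)]; ring
      · rw [abs_of_neg (by linarith)]; ring
    simp_rw [this, Finset.sum_sub_distrib, ← Finset.mul_sum, hp1, hq1]
    ring
  have hbd : ∀ r : α → ℝ, (∀ x, 0 ≤ r x) → ∑ x, r x = 1 →
      0 ≤ ∑ x, r x * f x ∧ ∑ x, r x * f x ≤ 1 := fun r hr hr1 =>
    ⟨Finset.sum_nonneg fun x _ => mul_nonneg (hr x) (hf0 x),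
      (Finset.sum_le_sum fun x _ => mul_le_of_le_one_right (hr x) (hf1 x)).trans hr1.le⟩
  obtain ⟨hu0, hu1⟩ := hbd p hp hp1
  obtain ⟨hv0, hv1⟩ := hbd q hq hq1
  set a := √(1 - y ^ 2)
  have ha : a ^ 2 = 1 - y ^ 2 := Real.sq_sqrt (by linarith)
  have hexp : ∀ r : α → ℝ, ∑ x, r x = 1 →
      ∑ x, (r x : ℂ) * ((a : ℂ) + ((y * (f x - (u + v) / 2) : ℝ) : ℂ) * Complex.I) =
        (a : ℂ) + ((y * (∑ x, r x * f x - (u + v) / 2) : ℝ) : ℂ) * Complex.I := fun r hr => by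
    have hr' : ∑ x, (r x : ℂ) = 1 := by exact_mod_cast hr
    calc _ = ∑ x, ((r x : ℂ) * (a - y * ((u + v) / 2) * Complex.I)
            + (r x * f x : ℂ) * (y * Complex.I)) :=
          Finset.sum_congr rfl fun x _ => by push_cast; ring
      _ = _ := by
          rw [Finset.sum_add_distrib, ← Finset.sum_mul, ← Finset.sum_mul, hr']
          push_cast
          ring
  -- Centring `f` at the midpoint of its two means makes the expectations conjugate.
  refine ⟨fun x => (a : ℂ) + ((y * (f x - (u + v) / 2) : ℝ) : ℂ) * Complex.I, fun x => ?_, ?_, ?_⟩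
  · rw [Complex.norm_add_mul_I, Real.sqrt_le_one]
    have : (f x - (u + v) / 2) ^ 2 ≤ 1 := by
      rw [sq_le_one_iff_abs_le_one, abs_le]
      constructor <;> linarith [hf0 x, hf1 x]
    nlinarith [sq_nonneg y]
  · rw [hexp p hp1, hδ, ← hu]
    push_cast
    ring
  · rw [hexp q hq1, hδ, ← hv]
    push_cast
    ring

/-- Expectations of product functions factor, and `z` minus its conjugate is `2 i z.im`; the 2
cancels the `1/2` in total variation. -/
theorem im_prod_le_sum_abs_prod_sub_prod {ι : Type*} [Fintype ι] [DecidableEq ι] {Ω : ι → Type*}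
    [∀ i, Fintype (Ω i)] (p q : ∀ i, Ω i → ℝ) (hp : ∀ i x, 0 ≤ p i x) (hq : ∀ i x, 0 ≤ q i x)
    (hp1 : ∀ i, ∑ x, p i x = 1) (hq1 : ∀ i, ∑ x, q i x = 1) (y : ι → ℝ)
    (hy : ∀ i, y i ^ 2 ≤ 1) :
    (∏ i, ((√(1 - y i ^ 2) : ℂ) +
      ((y i * ((1 / 2) * ∑ x, |p i x - q i x|) / 2 : ℝ) : ℂ) * Complex.I)).im ≤
      (1 / 2) * ∑ ω : ∀ i, Ω i, |∏ i, p i (ω i) - ∏ i, q i (ω i)| := by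
  choose ψ hψ hψp hψq using fun i =>
    exists_test_function (p i) (q i) (hp i) (hq i) (hp1 i) (hq1 i) (hy i)
  have hprod : ∀ r : ∀ i, Ω i → ℝ, ∑ ω : ∀ i, Ω i, ((∏ i, r i (ω i) : ℝ) : ℂ) * ∏ i, ψ i (ω i) =
      ∏ i, ∑ x, (r i x : ℂ) * ψ i x := fun r => by
    rw [Fintype.prod_sum]
    refine Finset.sum_congr rfl fun ω _ => ?_
    rw [Complex.ofReal_prod, Finset.prod_mul_distrib]
  have hle := norm_sum_sub_mul_le (fun ω : ∀ i, Ω i => ∏ i, p i (ω i)) (fun ω => ∏ i, q i (ω i))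
    (fun ω => ∏ i, ψ i (ω i)) fun ω => by
      rw [norm_prod]
      exact Finset.prod_le_one (fun _ _ => norm_nonneg _) fun i _ => hψ i (ω i)
  rw [hprod, hprod] at hle
  simp_rw [hψp, hψq] at hle
  set z := ∏ i, ((√(1 - y i ^ 2) : ℂ) +
      ((y i * ((1 / 2) * ∑ x, |p i x - q i x|) / 2 : ℝ) : ℂ) * Complex.I) with hz
  have hconj : ∏ i, ((√(1 - y i ^ 2) : ℂ) -
      ((y i * ((1 / 2) * ∑ x, |p i x - q i x|) / 2 : ℝ) : ℂ) * Complex.I) =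
      (starRingEnd ℂ) z := by
    rw [hz, map_prod]
    refine Finset.prod_congr rfl fun i _ => ?_
    rw [map_add, map_mul, Complex.conj_ofReal, Complex.conj_ofReal, Complex.conj_I]
    ring
  rw [hconj] at hle
  have him := (Complex.abs_im_le_norm _).trans hle
  rw [Complex.sub_im, Complex.conj_im] at him
  linarith [le_abs_self (z.im - -z.im)]

theorem theorem1 :
    ∃ c : ℝ, 0.1798 < c ∧
      ∀ (n : ℕ) (Ω : Fin n → Type*) [∀ i, Fintype (Ω i)] [∀ i, MeasurableSpace (Ω i)]
        [∀ i, MeasurableSingletonClass (Ω i)] (P Q : ∀ i, Measure (Ω i))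
        [∀ i, IsProbabilityMeasure (P i)] [∀ i, IsProbabilityMeasure (Q i)],
        c * min 1 ‖marginalTV P Q‖ ≤ tvDist (Measure.pi P) (Measure.pi Q) := by
  -- The argument yields `0.3 * 0.7 = 0.21`.
  refine ⟨0.2, by norm_num, ?_⟩
  intro n Ω _ _ _ P Q _ _
  have hsum : ∀ (μ : ∀ i, Measure (Ω i)) [∀ i, IsProbabilityMeasure (μ i)] (i : Fin n),
      ∑ x, (μ i).real {x} = 1 := fun μ _ i => by
    rw [sum_measureReal_singleton]
    simp
  have hpi : ∀ (μ : ∀ i, Measure (Ω i)) [∀ i, IsProbabilityMeasure (μ i)] (ω : ∀ i, Ω i),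
      (Measure.pi μ).real {ω} = ∏ i, (μ i).real {ω i} := fun μ _ ω => by
    simp [Measure.real, Measure.pi_singleton, ENNReal.toReal_prod]
  set δ : Fin n → ℝ := fun i => tvDist (P i) (Q i) with hδ
  have hδ0 : ∀ i, 0 ≤ δ i := fun i =>
    mul_nonneg (by norm_num) (Finset.sum_nonneg fun _ _ => abs_nonneg _)
  set s := ‖marginalTV P Q‖ with hs
  have hs2 : ∑ i, δ i ^ 2 = s ^ 2 := by
    rw [hs, EuclideanSpace.norm_sq_eq]
    simp [marginalTV, hδ]
  have hs0 : 0 ≤ s := norm_nonneg _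
  rcases hs0.eq_or_lt with h | hspos
  · rw [← h]
    simp only [zero_le_one, inf_of_le_right, mul_zero]
    exact mul_nonneg (by norm_num) (Finset.sum_nonneg fun _ _ => abs_nonneg _)
  set t := min 1 s with ht
  have htpos : 0 < t := lt_min one_pos hspos
  have hts : t ≤ s := min_le_right _ _
  have ht1 : t ≤ 1 := min_le_left _ _
  -- Parallel to `δ`, scaled so that `∑ y δ = 0.7 t` and `‖y‖ = 0.7 t / s ≤ 0.7`.
  set y : Fin n → ℝ := fun i => 0.7 * t / s ^ 2 * δ i with hy
  have hy0 : ∀ i, 0 ≤ y i := fun i => mul_nonneg (by positivity) (hδ0 i)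
  have hyδ : ∑ i, y i * δ i = 0.7 * t := by
    have : ∀ i, y i * δ i = 0.7 * t / s ^ 2 * δ i ^ 2 := fun i => by simp only [hy]; ring
    simp_rw [this, ← Finset.mul_sum, hs2]
    field_simp
  have hy2 : ∑ i, y i ^ 2 ≤ 0.49 := by
    have : ∀ i, y i ^ 2 = 0.49 * t ^ 2 / s ^ 4 * δ i ^ 2 := fun i => by
      simp only [hy]
      ring
    simp_rw [this, ← Finset.mul_sum, hs2]
    rw [show 0.49 * t ^ 2 / s ^ 4 * s ^ 2 = 0.49 * (t / s) ^ 2 by field_simp]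
    have h1 : t / s ≤ 1 := (div_le_one hspos).2 hts
    have h0 : 0 ≤ t / s := by positivity
    nlinarith
  have hy1 : ∀ i, y i ^ 2 ≤ 1 := fun i => by
    have := Finset.single_le_sum (f := fun i => y i ^ 2) (fun i _ => sq_nonneg _)
      (Finset.mem_univ i)
    linarith
  have hlow := le_im_prod Finset.univ y δ (fun i _ => hy0 i) (fun i _ => hδ0 i) hy2
    (by rw [hyδ]; linarith)
  have hup := im_prod_le_sum_abs_prod_sub_prod (fun i x => (P i).real {x})
    (fun i x => (Q i).real {x}) (fun _ _ => measureReal_nonneg) (fun _ _ => measureReal_nonneg)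
    (hsum P) (hsum Q) y hy1
  have htv : tvDist (Measure.pi P) (Measure.pi Q) =
      (1 / 2) * ∑ ω : ∀ i, Ω i, |∏ i, (P i).real {ω i} - ∏ i, (Q i).real {ω i}| := by
    simp only [tvDist, hpi]
  rw [hyδ] at hlow
  rw [htv]
  exact le_trans (by linarith) (hlow.trans hup)
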